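/- Let $V$ be a finite set of spins, each with local Hilbert space $\mathbb{C}^d$, and let $\mathcal H=\bigotimes_{v\in V}\mathbb{C}^d$. Let $S$ be a set of subsystems $X\subseteq V$. A $k$-local Hamiltonian on $S$ is an operator $H=\sum_{X\in S}\lambda_X h_X$ on $\mathcal H$ where $|X|\le k$ for all $X \in S$, each $\lambda_X$ is real with $|\lambda_X|\le 1$, and each $h_X$ is Hermitian with operator norm $\|h_X\|=1$ and support $X$ (that is, $X$ is the smallest subsystem on which $h_X$ acts nontrivially). The interaction graph of $S$ is the simple graph with vertex set $S$ in which distinct $X,Y\in S$ are adjacent if and only if $X\cap Y\neq\emptyset$. Let $\mathfrak d$ be its maximum degree, assume $\mathfrak d\ge 1$, and put $$t_L^*=\frac{1}{2e^2\,\mathfrak d(\mathfrak d+1)}.$$ Let $H^{(1)}$ and $H^{(2)}$ be $k$-local Hamiltonians on the same set $S$ (with possibly different coefficients and terms), let $\rho=\bigotimes_{v\in V}\rho_v$ be a product of single-spin density matrices, let $t\in\mathbb{R}$ with $|t|\le t_L^*/7$, and let $\delta\ge 0$. Put $\rho(t)=e^{-itH^{(1)}}\rho\, e^{itH^{(1)}}$.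 A projective measurement of $H^{(2)}$ in the state $\rho(t)$ yields an eigenvalue $x$ of $H^{(2)}$ with probability $\mathrm{Pr}(x)=\mathrm{tr}[\Pi(x)\rho(t)]$, where $\Pi(x)$ is the orthogonal projector onto the eigenspace of $H^{(2)}$ with eigenvalue $x$. Then $$\mathrm{Pr}\Big[\big|x-\mathrm{tr}\big(\rho(t)H^{(2)}\big)\big|\ge\delta\Big]\;\le\;2\exp\!\left(-\frac{(\delta\, t_L^*)^2}{250^2\,|S|}\right).$$ -/

import Mathlib

namespace ShortTimeDynamics

noncomputable section

/-- Configurations of the spins `V`; they label the product basis of `⨂_{v ∈ V} ℂ^d`. -/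
abbrev Config (V : Type*) (d : ℕ) : Type _ := V → Fin d

/-- Linear operators on the Hilbert space `⨂_{v ∈ V} ℂ^d`, written in the product basis. -/
abbrev Op (V : Type*) (d : ℕ) : Type _ := Matrix (Config V d) (Config V d) ℂ

variable {V : Type*} [Fintype V] [DecidableEq V] {d : ℕ}

/-- `A` acts trivially outside the subsystem `X`: it has the form `B ⊗ 1` for an operator `B`
on the spins of `X` and the identity `1` on the remaining spins. -/
def ActsOn (A : Op V d) (X : Finset V) : Prop :=
  ∃ B : Op X d, ∀ σ τ : Config V d,
    A σ τ = if ∀ v ∉ X, σ v = τ v then B (fun v => σ v) (fun v => τ v) else 0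

/-- `X` is the support of `A`: the smallest subsystem on which `A` acts nontrivially. -/
def HasSupport (A : Op V d) (X : Finset V) : Prop :=
  IsLeast {Y : Finset V | ActsOn A Y} X

/-- The operator norm induced by the Hilbert space norm. -/
def opNorm (A : Op V d) : ℝ :=
  ‖Matrix.toEuclideanCLM (n := Config V d) (𝕜 := ℂ) A‖

/-- A `k`-local Hamiltonian `∑_{X ∈ S} λ_X h_X` on the set of subsystems `S`. -/
structure LocalHamiltonian (d k : ℕ) (S : Finset (Finset V)) where
  /-- the real coefficients `λ_X` -/
  coeff : S → ℝ
  /-- the operators `h_X` -/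
  term : S → Op V d
  card_le : ∀ X : S, (X : Finset V).card ≤ k
  abs_coeff_le : ∀ X, |coeff X| ≤ 1
  isHermitian_term : ∀ X, (term X).IsHermitian
  hasSupport_term : ∀ X, HasSupport (term X) X
  norm_term : ∀ X, opNorm (term X) = 1

/-- The operator `H = ∑_{X ∈ S} λ_X h_X`. -/
def LocalHamiltonian.toOp {k : ℕ} {S : Finset (Finset V)}
    (H : LocalHamiltonian d k S) : Op V d :=
  ∑ X : S, (H.coeff X : ℂ) • H.term X

/-- The interaction graph: its vertices are the subsystems in `S`, and two distinct ones are
adjacent when they overlap. -/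
def interactionGraph (S : Finset (Finset V)) : SimpleGraph S where
  Adj X Y := X ≠ Y ∧ ((X : Finset V) ∩ (Y : Finset V)).Nonempty
  symm := ⟨fun _ _ h => ⟨h.1.symm, by rw [Finset.inter_comm]; exact h.2⟩⟩
  loopless := ⟨fun _ h => h.1 rfl⟩

open Classical in
/-- The maximum degree `𝔡` of the interaction graph. -/
def interactionDegree (S : Finset (Finset V)) : ℕ :=
  (interactionGraph S).maxDegree

/-- The threshold time `t_L^* = 1 / (2 e² 𝔡 (𝔡 + 1))`, which is meaningful for `𝔡 ≥ 1`. -/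
def thresholdTime (S : Finset (Finset V)) : ℝ :=
  1 / (2 * Real.exp 1 ^ 2 * (interactionDegree S : ℝ) * ((interactionDegree S : ℝ) + 1))

open scoped ComplexOrder in
/-- `ρ = ⨂_v ρ_v` for density matrices `ρ_v` (positive semidefinite with unit trace) of the
single spins. -/
def IsProductState (ρ : Op V d) : Prop :=
  ∃ r : V → Matrix (Fin d) (Fin d) ℂ,
    (∀ v, (r v).PosSemidef ∧ (r v).trace = 1) ∧
      ∀ σ τ : Config V d, ρ σ τ = ∏ v, r v (σ v) (τ v)

/-- The evolved state `e^{-itH} ρ e^{itH}`. -/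
def evolve (H : Op V d) (t : ℝ) (ρ : Op V d) : Op V d :=
  NormedSpace.exp ((-(Complex.I * (t : ℂ))) • H) * ρ *
    NormedSpace.exp ((Complex.I * (t : ℂ)) • H)

/-- The expectation value `tr (ρ A)`. It is real for a state `ρ` and a Hermitian `A`. -/
def mean (ρ A : Op V d) : ℝ := (ρ * A).trace.re

/-- The orthogonal projector `Π(x)` onto the eigenspace of `A` with eigenvalue `x`. -/
def eigenProjector (A : Op V d) (x : ℝ) : Op V d :=
  (Matrix.toEuclideanCLM (n := Config V d) (𝕜 := ℂ)).symm
    (Module.End.eigenspace (Matrix.toEuclideanLin A) (x : ℂ)).starProjection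

/-- The probability `tr (Π(x) ρ)` of the outcome `x` in a projective measurement of `A` in the
state `ρ`. It is real for a state `ρ`. -/
def outcomeProb (ρ A : Op V d) (x : ℝ) : ℝ := (eigenProjector A x * ρ).trace.re

/-- The finite set of possible outcomes of a measurement of `A`, its real eigenvalues. -/
def outcomes (A : Op V d) : Finset ℝ :=
  (Matrix.finite_real_spectrum (A := A)).toFinset

/-- The probability that a projective measurement of `A` in the state `ρ` yields a value `x` with
`|x - tr (ρ A)| ≥ δ`. -/
def deviationProb (ρ A : Op V d) (δ : ℝ) : ℝ :=
  ∑ x ∈ outcomes A with δ ≤ |x - mean ρ A|, outcomeProb ρ A x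

end

end ShortTimeDynamics

/-!
The proof is a Chernoff bound. Writing `ρ(t)` for the evolved state, it suffices to show that
`log tr (ρ(t) e^{τ H₂}) ≤ τ tr (ρ(t) H₂) + 2 |S| τ² / t_L*²` for real `|τ| < t_L*`. The left side is
the logarithm of the partition function `F_A(z) = tr (ρ e^{itH₁} e^{zH₂} e^{-itH₁})` at `A = S`,
where for `A ⊆ S` only the terms on subsystems in `A` are kept in `H₁` and `H₂`
(`partitionFunction`).

Two facts about `F` are used. As `ρ` is a product state, `F_{A ∪ B} = F_A F_B` when no subsystem in
`A` meets one in `B` (`IsProductState.trace_tripleExp_union`). The Möbius transform of `F` at `D` is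
at most `(e^{2|t| + |z|} - 1)^{|D|}` (`norm_setDiff_trace_tripleExp_le`): the operator-valued set
function is majorized, difference by difference, by the scalar one in which every term is replaced
by a bound on its norm, because majorization survives sums, products and exponentials
(`MajorizedOn`).

These two facts replace a convergent cluster expansion. Let `G(D, A)` be the iterated difference of
`F` in the directions `D`, based at `A` (`setDiff`). Then
`G(D, A ∪ {Y}) = G(D, A) + G(D ∪ {Y}, A)`, and `G(D, A)` is `F_A` times the Möbius transform at `D`
as soon as nothing in `A` is adjacent to `D`. Exploring the sites adjacent to `D` one at a time
bounds `G(D, A)` relative to `F_A`, by induction on `|A|` (`norm_setDiff_le`). For `D = {X}` this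
says that each ratio `F_{A ∪ {X}} / F_A` lies within `1 / (3𝔡)` of `1` for all complex `|z| < t_L*`.

The telescoping product of these ratios has an analytic logarithm on the disk of radius `t_L*`, of
size at most `|S|` (`exists_log`), and the Schwarz lemma applied twice controls its second-order
Taylor remainder (`norm_sub_deriv_mul_le`). The first-order term is the mean of `H₂`. The Chernoff
exponent stays in the disk because outcomes never deviate from the mean by more than `2 |S|`.
-/

namespace ShortTimeDynamics

/-! ### Finite differences of set functions -/

section Difference

variable {ι : Type*} [DecidableEq ι] {𝔸 : Type*}

/-- The iterated difference of the set function `F` in the directions `D`, based at `A`. It equals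
`F A` when `D` is empty, and the Möbius transform of `F` at `D` when `A` is empty. The sign
`(-1) ^ (|D| + |B|)` is `(-1) ^ |D \ B|`, as `B ⊆ D`. -/
def setDiff [AddCommGroup 𝔸] (D : Finset ι) (F : Finset ι → 𝔸) (A : Finset ι) : 𝔸 :=
  ∑ B ∈ D.powerset, (-1 : ℤ) ^ (D.card + B.card) • F (A ∪ B)

@[simp] lemma setDiff_empty [AddCommGroup 𝔸] (F : Finset ι → 𝔸) (A : Finset ι) :
    setDiff ∅ F A = F A := by
  simp [setDiff]

lemma setDiff_insert [AddCommGroup 𝔸] {D : Finset ι} {Y : ι} (hY : Y ∉ D) (F : Finset ι → 𝔸)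
    (A : Finset ι) :
    setDiff (insert Y D) F A = setDiff D F (insert Y A) - setDiff D F A := by
  unfold setDiff
  rw [Finset.sum_powerset_insert hY, add_comm, sub_eq_add_neg, ← Finset.sum_neg_distrib]
  congr 1
  · refine Finset.sum_congr rfl fun B hB => ?_
    have hYB : Y ∉ B := fun h => hY (Finset.mem_powerset.1 hB h)
    rw [Finset.card_insert_of_notMem hY, Finset.card_insert_of_notMem hYB, Finset.insert_union,
      Finset.union_insert, show D.card + 1 + (B.card + 1) = D.card + B.card + 2 by ring, pow_add]
    simp
  · refine Finset.sum_congr rfl fun B _ => ?_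
    rw [Finset.card_insert_of_notMem hY, show D.card + 1 + B.card = D.card + B.card + 1 by ring,
      pow_succ]
    simp

/-- Taking one more difference is the same as differencing the differenced function. -/
lemma setDiff_insert_eq [AddCommGroup 𝔸] {D : Finset ι} {Y : ι} (hY : Y ∉ D) (F : Finset ι → 𝔸)
    (A : Finset ι) :
    setDiff (insert Y D) F A = setDiff D (fun B => F (insert Y B) - F B) A := by
  rw [setDiff_insert hY]
  simp only [setDiff, smul_sub, Finset.sum_sub_distrib, Finset.insert_union]

lemma setDiff_shift [AddCommGroup 𝔸] (D : Finset ι) (Y : ι) (F : Finset ι → 𝔸) (A : Finset ι) :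
    setDiff D (fun B => F (insert Y B)) A = setDiff D F (insert Y A) := by
  simp only [setDiff, Finset.insert_union]

lemma setDiff_add [AddCommGroup 𝔸] (D : Finset ι) (F G : Finset ι → 𝔸) (A : Finset ι) :
    setDiff D (fun B => F B + G B) A = setDiff D F A + setDiff D G A := by
  simp only [setDiff, smul_add, Finset.sum_add_distrib]

lemma setDiff_map {𝔹 : Type*} [AddCommGroup 𝔸] [AddCommGroup 𝔹] (f : 𝔸 →+ 𝔹) (D : Finset ι)
    (F : Finset ι → 𝔸) (A : Finset ι) :
    setDiff D (fun B => f (F B)) A = f (setDiff D F A) := by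
  simp [setDiff, map_sum, map_zsmul]

lemma hasSum_setDiff [NormedAddCommGroup 𝔸] {F : ℕ → Finset ι → 𝔸} {G : Finset ι → 𝔸}
    (h : ∀ B, HasSum (fun n => F n B) (G B)) (D A : Finset ι) :
    HasSum (fun n => setDiff D (F n) A) (setDiff D G A) :=
  hasSum_sum fun B _ => (h (A ∪ B)).const_smul _

lemma setDiff_exp_card (s : ℝ) (D A : Finset ι) (h : Disjoint D A) :
    setDiff D (fun B => Real.exp (s * B.card)) A
      = (Real.exp s - 1) ^ D.card * Real.exp (s * A.card) := by
  induction D using Finset.induction_on generalizing A with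
  | empty => simp
  | insert Y D hY ih =>
    rw [Finset.disjoint_insert_left] at h
    rw [setDiff_insert hY, ih _ h.2, ih, Finset.card_insert_of_notMem h.1,
      Finset.card_insert_of_notMem hY]
    · push_cast
      rw [mul_add, Real.exp_add, mul_one]
      ring
    · rw [Finset.disjoint_insert_right]
      exact ⟨hY, h.2⟩

/-- If `F` factorizes between `A` and the subsets of `D`, so do its differences. -/
lemma setDiff_eq_mul [CommRing 𝔸] {D A : Finset ι} {F : Finset ι → 𝔸}
    (h : ∀ B ⊆ D, F (A ∪ B) = F A * F B) : setDiff D F A = F A * setDiff D F ∅ := by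
  unfold setDiff
  rw [Finset.mul_sum]
  refine Finset.sum_congr rfl fun B hB => ?_
  rw [h B (Finset.mem_powerset.1 hB), Finset.empty_union, mul_smul_comm]

end Difference

/-! ### Majorization of set functions -/

section Majorization

variable {ι : Type*} [DecidableEq ι] {𝔸 : Type*}

/-- The differences of `E` in directions from `U` are bounded in norm by those of the real set
function `e`. -/
def MajorizedOn [NormedAddCommGroup 𝔸] (U : Finset ι) (E : Finset ι → 𝔸) (e : Finset ι → ℝ) :
    Prop :=
  ∀ D ⊆ U, ∀ A, ‖setDiff D E A‖ ≤ setDiff D e A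

lemma MajorizedOn.norm_le [NormedAddCommGroup 𝔸] {U : Finset ι} {E : Finset ι → 𝔸}
    {e : Finset ι → ℝ} (h : MajorizedOn U E e) (A : Finset ι) : ‖E A‖ ≤ e A := by
  simpa using h ∅ (Finset.empty_subset _) A

lemma MajorizedOn.mono [NormedAddCommGroup 𝔸] {U W : Finset ι} {E : Finset ι → 𝔸}
    {e : Finset ι → ℝ} (h : MajorizedOn U E e) (hW : W ⊆ U) : MajorizedOn W E e :=
  fun D hD A => h D (hD.trans hW) A

lemma MajorizedOn.shift [NormedAddCommGroup 𝔸] {U : Finset ι} {E : Finset ι → 𝔸}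
    {e : Finset ι → ℝ} (h : MajorizedOn U E e) (Y : ι) :
    MajorizedOn U (fun B => E (insert Y B)) (fun B => e (insert Y B)) := fun D hD A => by
  rw [setDiff_shift, setDiff_shift]
  exact h D hD _

lemma MajorizedOn.diff [NormedAddCommGroup 𝔸] {U : Finset ι} {E : Finset ι → 𝔸}
    {e : Finset ι → ℝ} {Y : ι} (hY : Y ∉ U) (h : MajorizedOn (insert Y U) E e) :
    MajorizedOn U (fun B => E (insert Y B) - E B) (fun B => e (insert Y B) - e B) := by
  intro D hD A
  have hYD : Y ∉ D := fun h' => hY (hD h')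
  rw [← setDiff_insert_eq hYD, ← setDiff_insert_eq hYD]
  exact h _ (Finset.insert_subset_insert _ hD) A

lemma MajorizedOn.add [NormedAddCommGroup 𝔸] {U : Finset ι} {E E' : Finset ι → 𝔸}
    {e e' : Finset ι → ℝ} (h : MajorizedOn U E e) (h' : MajorizedOn U E' e') :
    MajorizedOn U (fun B => E B + E' B) (fun B => e B + e' B) := fun D hD A => by
  rw [setDiff_add, setDiff_add]
  exact (norm_add_le _ _).trans (add_le_add (h D hD A) (h' D hD A))

/-- Majorization passes to products, by the Leibniz rule for differences,
`Δ(E E') = ΔE · E'(Y ∪ ·) + E · ΔE'`. -/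
lemma MajorizedOn.mul [NormedRing 𝔸] {U : Finset ι} {E E' : Finset ι → 𝔸}
    {e e' : Finset ι → ℝ} (h : MajorizedOn U E e) (h' : MajorizedOn U E' e') :
    MajorizedOn U (fun B => E B * E' B) (fun B => e B * e' B) := by
  induction U using Finset.induction_on generalizing E E' e e' with
  | empty =>
    intro D hD A
    obtain rfl := Finset.subset_empty.1 hD
    simp only [setDiff_empty]
    exact (norm_mul_le _ _).trans (mul_le_mul (h.norm_le A) (h'.norm_le A) (norm_nonneg _)
      ((norm_nonneg _).trans (h.norm_le A)))
  | insert Y U hY ih =>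
    intro D hD A
    by_cases hYD : Y ∈ D
    · have hYD' := Finset.notMem_erase Y D
      have hDU : D.erase Y ⊆ U := by rwa [← Finset.subset_insert_iff]
      have hU := Finset.subset_insert Y U
      have key := (ih (h.diff hY) ((h'.shift Y).mono hU)).add (ih (h.mono hU) (h'.diff hY))
        (D.erase Y) hDU A
      rw [← Finset.insert_erase hYD, setDiff_insert_eq hYD', setDiff_insert_eq hYD']
      convert key using 3
      · noncomm_ring
      · ring
    · have hDU : D ⊆ U := by
        rw [Finset.subset_insert_iff, Finset.erase_eq_of_notMem hYD] at hD
        exact hD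
      exact ih (h.mono (Finset.subset_insert _ _)) (h'.mono (Finset.subset_insert _ _)) D hDU A

lemma MajorizedOn.sum [NormedAddCommGroup 𝔸] {κ : Type*} {U : Finset ι}
    {E : κ → Finset ι → 𝔸} {e : κ → Finset ι → ℝ} (T : Finset κ)
    (h : ∀ k, MajorizedOn U (E k) (e k)) :
    MajorizedOn U (fun B => ∑ k ∈ T, E k B) (fun B => ∑ k ∈ T, e k B) := by
  classical
  induction T using Finset.induction_on with
  | empty => intro D _ A; simp [setDiff]
  | insert k T hk ih =>
    simp only [Finset.sum_insert hk]
    exact (h k).add ih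

lemma majorizedOn_one [NormedRing 𝔸] [NormOneClass 𝔸] (U : Finset ι) :
    MajorizedOn U (fun _ => (1 : 𝔸)) (fun _ => 1) := by
  intro D _ A
  rcases D.eq_empty_or_nonempty with rfl | ⟨Y, hY⟩
  · simp
  · rw [← Finset.insert_erase hY, setDiff_insert_eq (Finset.notMem_erase Y D),
      setDiff_insert_eq (Finset.notMem_erase Y D)]
    simp [setDiff]

lemma MajorizedOn.pow [NormedRing 𝔸] [NormOneClass 𝔸] {U : Finset ι} {E : Finset ι → 𝔸}
    {e : Finset ι → ℝ} (h : MajorizedOn U E e) (n : ℕ) :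
    MajorizedOn U (fun B => E B ^ n) (fun B => e B ^ n) := by
  induction n with
  | zero => simpa using majorizedOn_one (𝔸 := 𝔸) U
  | succ n ih => simpa only [pow_succ] using ih.mul h

/-- The exponential series has nonnegative coefficients, so majorization passes to it. -/
lemma MajorizedOn.exp [NormedRing 𝔸] [NormOneClass 𝔸] [NormedAlgebra ℂ 𝔸] [CompleteSpace 𝔸]
    {U : Finset ι} {E : Finset ι → 𝔸} {e : Finset ι → ℝ} (h : MajorizedOn U E e) :
    MajorizedOn U (fun B => NormedSpace.exp (E B)) (fun B => Real.exp (e B)) := by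
  intro D hD A
  have h1 := hasSum_setDiff
    (fun B => NormedSpace.exp_series_hasSum_exp' (𝕂 := ℂ) (E B)) D A
  have h2 := hasSum_setDiff
    (fun B => NormedSpace.exp_series_hasSum_exp' (𝕂 := ℝ) (e B)) D A
  rw [← Real.exp_eq_exp_ℝ] at h2
  refine h1.norm_le_of_bounded h2 fun n => ?_
  have e1 := setDiff_map (DistribSMul.toAddMonoidHom 𝔸 ((n.factorial : ℂ)⁻¹)) D
    (fun B => E B ^ n) A
  have e2 := setDiff_map (DistribSMul.toAddMonoidHom ℝ ((n.factorial : ℝ)⁻¹)) D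
    (fun B => e B ^ n) A
  simp only [DistribSMul.toAddMonoidHom_apply] at e1 e2
  rw [e1, e2, norm_smul, smul_eq_mul, norm_inv, Complex.norm_natCast]
  exact mul_le_mul_of_nonneg_left (h.pow n D hD A) (by positivity)

/-- The indicator of `X ∈ B` has nonnegative differences. -/
lemma setDiff_indicator_nonneg (X : ι) (D A : Finset ι) :
    0 ≤ setDiff D (fun B => if X ∈ B then (1 : ℝ) else 0) A := by
  by_cases h : ∃ Y ∈ D, Y ≠ X
  · obtain ⟨Y, hY, hYX⟩ := h
    rw [← Finset.insert_erase hY, setDiff_insert_eq (Finset.notMem_erase Y D)]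
    simp [Finset.mem_insert, hYX.symm, setDiff]
  · push Not at h
    rcases Finset.subset_singleton_iff.1 (fun Y hY => Finset.mem_singleton.2 (h Y hY) : D ⊆ {X})
      with rfl | rfl
    · simp only [setDiff_empty]; split_ifs <;> norm_num
    · rw [← insert_empty_eq, setDiff_insert (Finset.notMem_empty X)]
      simp only [setDiff_empty, Finset.mem_insert_self, if_true]
      split_ifs <;> norm_num

lemma majorizedOn_sum_of_norm_le [NormedAddCommGroup 𝔸] [NormedSpace ℝ 𝔸] (U : Finset ι)
    {h : ι → 𝔸} {s : ℝ} (hs : ∀ X, ‖h X‖ ≤ s) [Fintype ι] :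
    MajorizedOn U (fun B => ∑ X ∈ B, h X) (fun B => s * B.card) := by
  have key : MajorizedOn U (fun B => ∑ X, (if X ∈ B then (1 : ℝ) else 0) • h X)
      (fun B => ∑ X, (if X ∈ B then (1 : ℝ) else 0) * s) := by
    refine MajorizedOn.sum (E := fun X B => (if X ∈ B then (1 : ℝ) else 0) • h X)
      (e := fun X B => (if X ∈ B then (1 : ℝ) else 0) * s) _ fun X D _ A => ?_
    have e1 := setDiff_map ((AddMonoidHom.flip (smulAddHom ℝ 𝔸)) (h X)) D
      (fun B => if X ∈ B then (1 : ℝ) else 0) A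
    have e2 := setDiff_map (AddMonoidHom.mulRight s) D
      (fun B => if X ∈ B then (1 : ℝ) else 0) A
    simp only [AddMonoidHom.flip_apply, smulAddHom_apply, AddMonoidHom.coe_mulRight] at e1 e2
    rw [e1, e2, norm_smul, Real.norm_of_nonneg (setDiff_indicator_nonneg X D A)]
    exact mul_le_mul_of_nonneg_left (hs X) (setDiff_indicator_nonneg X D A)
  convert key using 2 with B B
  · simp [ite_smul, Finset.sum_ite_mem]
  · rw [← Finset.sum_mul]; simp [mul_comm]

end Majorization

/-! ### Ratios of factorizing set functions -/

/-- The case of one explored site, which has at most `Δ` neighbours in `A`. -/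
lemma norm_insert_sub_le_of_setDiff_singleton {ι : Type*} [Fintype ι] [DecidableEq ι]
    (G : SimpleGraph ι) [DecidableRel G.Adj] {F : Finset ι → ℂ} {x a ε : ℝ} {Δ : ℕ}
    (hΔ : ∀ X, G.degree X ≤ Δ) (hx : 0 ≤ x) (ha : 1 ≤ a) (hε : x * a ^ Δ ≤ ε) {Y : ι}
    {A : Finset ι}
    (h : ‖setDiff {Y} F A‖ ≤ x ^ ({Y} : Finset ι).card *
      a ^ (A.filter fun Z => ∃ X ∈ ({Y} : Finset ι), G.Adj X Z).card * ‖F A‖) :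
    ‖F (insert Y A) - F A‖ ≤ ε * ‖F A‖ := by
  rw [← insert_empty_eq, setDiff_insert (Finset.notMem_empty Y), setDiff_empty,
    setDiff_empty] at h
  refine h.trans (mul_le_mul_of_nonneg_right (le_trans ?_ hε) (norm_nonneg _))
  simp only [insert_empty_eq, Finset.card_singleton, pow_one]
  refine mul_le_mul_of_nonneg_left (pow_le_pow_right₀ ha ?_) hx
  refine le_trans (Finset.card_le_card fun Z hZ => ?_) (hΔ Y)
  simpa using (Finset.mem_filter.1 hZ).2

/-- The exploration argument. When `F` factorizes over non-adjacent sets and its differences decay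
like `x ^ |D|`, removing one site changes `F` by a relative amount at most `ε`. The sites of `A`
adjacent to `D` are removed one by one: each is either left out, or it joins `D` and gains a
factor `x` at the cost of at most `Δ` new adjacent sites, each of which costs a factor `a`. -/
theorem norm_setDiff_le {ι : Type*} [Fintype ι] [DecidableEq ι] (G : SimpleGraph ι)
    [DecidableRel G.Adj]
    {F : Finset ι → ℂ} {x a ε : ℝ} {Δ : ℕ} (hΔ : ∀ X, G.degree X ≤ Δ) (hx : 0 ≤ x) (ha : 1 ≤ a)
    (hε : x * a ^ Δ ≤ ε) (haε : 1 + ε ≤ a * (1 - ε))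
    (hF : ∀ A B, Disjoint A B → (∀ X ∈ A, ∀ Y ∈ B, ¬ G.Adj X Y) → F (A ∪ B) = F A * F B)
    (hx' : ∀ D, ‖setDiff D F ∅‖ ≤ x ^ D.card) (D A : Finset ι) (hDA : Disjoint D A) :
    ‖setDiff D F A‖ ≤
      x ^ D.card * a ^ (A.filter fun Y => ∃ X ∈ D, G.Adj X Y).card * ‖F A‖ := by
  induction hn : A.card generalizing A D with
  | zero =>
    obtain rfl := Finset.card_eq_zero.1 hn
    have h1 := setDiff_eq_mul (D := D) (A := ∅) (F := F)
      fun B _ => hF ∅ B (Finset.disjoint_empty_left _) (by simp)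
    rw [h1, norm_mul]
    simp only [Finset.filter_empty, Finset.card_empty, pow_zero, mul_one]
    rw [mul_comm]
    exact mul_le_mul_of_nonneg_right (hx' D) (norm_nonneg _)
  | succ n ih =>
    rcases (A.filter fun Y => ∃ X ∈ D, G.Adj X Y).eq_empty_or_nonempty with h0 | ⟨Y, hYf⟩
    · have h1 := setDiff_eq_mul (D := D) (A := A) (F := F) fun B hB =>
        hF A B (hDA.mono_left hB).symm fun Z hZ X hX hadj =>
          Finset.notMem_empty Z (h0 ▸ Finset.mem_filter.2 ⟨hZ, X, hB hX, hadj.symm⟩)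
      rw [h1, h0, norm_mul, Finset.card_empty, pow_zero, mul_one, mul_comm]
      exact mul_le_mul_of_nonneg_right (hx' D) (norm_nonneg _)
    · obtain ⟨hYA, X₀, hX₀, hadj⟩ := Finset.mem_filter.1 hYf
      have hYD : Y ∉ D := fun h => Finset.disjoint_left.1 hDA h hYA
      have hYA' : Y ∉ A.erase Y := Finset.notMem_erase Y A
      have hins : insert Y (A.erase Y) = A := Finset.insert_erase hYA
      have hcard : (A.erase Y).card = n := by rw [Finset.card_erase_of_mem hYA, hn]; rfl
      have hDA' : Disjoint D (A.erase Y) := hDA.mono_right (Finset.erase_subset _ _)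
      have hsingle : ‖F A - F (A.erase Y)‖ ≤ ε * ‖F (A.erase Y)‖ := by
        have h1 := norm_insert_sub_le_of_setDiff_singleton G hΔ hx ha hε
          (ih {Y} (A.erase Y) (Finset.disjoint_singleton_left.2 hYA') hcard)
        rwa [hins] at h1
      have hratio : (1 - ε) * ‖F (A.erase Y)‖ ≤ ‖F A‖ := by
        have := norm_sub_norm_le (F (A.erase Y)) (F A)
        rw [norm_sub_rev] at this
        linarith
      have hB1 := ih D (A.erase Y) hDA' hcard
      have hB2 := ih (insert Y D) (A.erase Y)
        (Finset.disjoint_insert_left.2 ⟨hYA', hDA'⟩) hcard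
      obtain ⟨m, hm⟩ : ∃ m, (A.filter fun Y => ∃ X ∈ D, G.Adj X Y).card = m + 1 :=
        Nat.exists_eq_succ_of_ne_zero (Finset.card_ne_zero_of_mem hYf)
      have hm1 : ((A.erase Y).filter fun Y => ∃ X ∈ D, G.Adj X Y).card ≤ m := by
        rw [Finset.filter_erase, Finset.card_erase_of_mem hYf, hm]; simp
      -- Once `Y` is explored, at most `Δ` further sites become adjacent to the explored set.
      have hm2 : ((A.erase Y).filter fun Z => ∃ X ∈ insert Y D, G.Adj X Z).card ≤ m + Δ := by
        refine le_trans (Finset.card_le_card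
          (t := ((A.erase Y).filter fun Y => ∃ X ∈ D, G.Adj X Y) ∪ G.neighborFinset Y)
          fun Z hZ => ?_)
          ((Finset.card_union_le _ _).trans (add_le_add hm1 (hΔ Y)))
        obtain ⟨hZ1, X, hX, hXZ⟩ := Finset.mem_filter.1 hZ
        rcases Finset.mem_insert.1 hX with rfl | hX
        · exact Finset.mem_union_right _ (by simpa using hXZ)
        · exact Finset.mem_union_left _ (Finset.mem_filter.2 ⟨hZ1, X, hX, hXZ⟩)
      have hsplit : setDiff D F A =
          setDiff D F (A.erase Y) + setDiff (insert Y D) F (A.erase Y) := by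
        rw [setDiff_insert hYD, hins]; abel
      have ha0 : 0 ≤ a := zero_le_one.trans ha
      rw [hsplit, hm]
      calc ‖setDiff D F (A.erase Y) + setDiff (insert Y D) F (A.erase Y)‖
          ≤ x ^ D.card * a ^ m * ‖F (A.erase Y)‖
              + x ^ (D.card + 1) * a ^ (m + Δ) * ‖F (A.erase Y)‖ := by
            refine (norm_add_le _ _).trans (add_le_add (hB1.trans ?_) (hB2.trans ?_))
            · gcongr
            · rw [Finset.card_insert_of_notMem hYD]
              gcongr
        _ = x ^ D.card * a ^ m * ((1 + x * a ^ Δ) * ‖F (A.erase Y)‖) := by ring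
        _ ≤ x ^ D.card * a ^ m * (a * ‖F A‖) := by
            refine mul_le_mul_of_nonneg_left ?_ (by positivity)
            calc (1 + x * a ^ Δ) * ‖F (A.erase Y)‖ ≤ (1 + ε) * ‖F (A.erase Y)‖ := by gcongr
              _ ≤ a * (1 - ε) * ‖F (A.erase Y)‖ := by gcongr
              _ = a * ((1 - ε) * ‖F (A.erase Y)‖) := by ring
              _ ≤ a * ‖F A‖ := by gcongr
        _ = x ^ D.card * a ^ (m + 1) * ‖F A‖ := by ring

lemma norm_insert_sub_le {ι : Type*} [Fintype ι] [DecidableEq ι] (G : SimpleGraph ι)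
    [DecidableRel G.Adj]
    {F : Finset ι → ℂ} {x a ε : ℝ} {Δ : ℕ} (hΔ : ∀ X, G.degree X ≤ Δ) (hx : 0 ≤ x) (ha : 1 ≤ a)
    (hε : x * a ^ Δ ≤ ε) (haε : 1 + ε ≤ a * (1 - ε))
    (hF : ∀ A B, Disjoint A B → (∀ X ∈ A, ∀ Y ∈ B, ¬ G.Adj X Y) → F (A ∪ B) = F A * F B)
    (hx' : ∀ D, ‖setDiff D F ∅‖ ≤ x ^ D.card) (Y : ι) (A : Finset ι) (hY : Y ∉ A) :
    ‖F (insert Y A) - F A‖ ≤ ε * ‖F A‖ :=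
  norm_insert_sub_le_of_setDiff_singleton G hΔ hx ha hε
    (norm_setDiff_le G hΔ hx ha hε haε hF hx' {Y} A (Finset.disjoint_singleton_left.2 hY))

/-! ### Product states and operators on disjoint regions -/

section Regions

open Matrix
open scoped Kronecker Matrix.Norms.L2Operator ComplexOrder

variable {V : Type*} [Fintype V] [DecidableEq V] {d : ℕ}

lemma nonempty_of_trace_eq_one {n : Type*} [Fintype n] {ρ : Matrix n n ℂ} (h : ρ.trace = 1) :
    Nonempty n := by
  by_contra hn
  rw [not_nonempty_iff] at hn
  simp [Matrix.trace] at h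

open scoped MatrixOrder in
lemma exists_eq_conjTranspose_mul_self {n : Type*} [Fintype n] [DecidableEq n] {ρ : Matrix n n ℂ}
    (hρ : ρ.PosSemidef) : ∃ B : Matrix n n ℂ, ρ = Bᴴ * B :=
  CStarAlgebra.nonneg_iff_eq_star_mul_self.1 hρ.nonneg

/-- A state is a functional of norm at most one on operators. -/
lemma norm_trace_mul_le {n : Type*} [Fintype n] [DecidableEq n] {ρ : Matrix n n ℂ}
    (hρ : ρ.PosSemidef) (h1 : ρ.trace = 1) (M : Matrix n n ℂ) : ‖(ρ * M).trace‖ ≤ ‖M‖ := by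
  obtain ⟨B, rfl⟩ := exists_eq_conjTranspose_mul_self hρ
  let v : n → EuclideanSpace ℂ n := fun i => WithLp.toLp 2 (star (B i))
  have key : ∀ M : Matrix n n ℂ, (Bᴴ * B * M).trace
      = ∑ i, inner ℂ (v i) (Matrix.toEuclideanCLM (n := n) (𝕜 := ℂ) M (v i)) := by
    intro M
    rw [Matrix.mul_assoc, Matrix.trace_mul_comm, Matrix.trace]
    refine Finset.sum_congr rfl fun i _ => ?_
    rw [EuclideanSpace.inner_eq_star_dotProduct, Matrix.ofLp_toEuclideanCLM, dotProduct_comm]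
    simp only [v, star_star, Matrix.diag_apply, Matrix.mul_assoc]
    simp only [Matrix.mul_apply, dotProduct, Matrix.mulVec, Matrix.conjTranspose_apply,
      Pi.star_apply]
  have hv : ∑ i, ‖v i‖ ^ 2 = 1 := by
    have h2 := key 1
    rw [Matrix.mul_one, h1, map_one] at h2
    have h3 : (((∑ i, ‖v i‖ ^ 2 : ℝ)) : ℂ) = 1 := by
      rw [h2]; push_cast
      exact Finset.sum_congr rfl fun i _ => (inner_self_eq_norm_sq_to_K (𝕜 := ℂ) (v i)).symm
    exact_mod_cast h3
  rw [key]
  calc _ ≤ ∑ i, ‖v i‖ ^ 2 * ‖M‖ := by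
        refine norm_sum_le_of_le _ fun i _ => (norm_inner_le_norm _ _).trans ?_
        rw [Matrix.cstar_norm_def, sq, mul_assoc]
        gcongr
        rw [mul_comm]
        exact ContinuousLinearMap.le_opNorm _ _
    _ = ‖M‖ := by rw [← Finset.sum_mul, hv, one_mul]

/-- Splitting a configuration into its parts inside and outside `P`. -/
def splitConfig (P : Finset V) (d : ℕ) :
    Config V d ≃ (P → Fin d) × ({v : V // v ∉ P} → Fin d) :=
  Equiv.piEquivPiSubtypeProd (· ∈ P) fun _ => Fin d

/-- The operator `α ⊗ β`, with `α` acting on the spins in `P` and `β` on the others. -/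
def tensor (P : Finset V) (α : Op P d) (β : Op {v : V // v ∉ P} d) : Op V d :=
  (α ⊗ₖ β).submatrix (splitConfig P d) (splitConfig P d)

omit [Fintype V] in
lemma tensor_apply (P : Finset V) (α : Op P d) (β : Op {v : V // v ∉ P} d) (σ τ : Config V d) :
    tensor P α β σ τ = α (fun v => σ v) (fun v => τ v) * β (fun v => σ v) (fun v => τ v) := rfl

lemma tensor_mul (P : Finset V) (α α' : Op P d) (β β' : Op {v : V // v ∉ P} d) :
    tensor P α β * tensor P α' β' = tensor P (α * α') (β * β') := by
  unfold tensor
  rw [Matrix.submatrix_mul_equiv, Matrix.mul_kronecker_mul]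

lemma tensor_one_one (P : Finset V) : tensor (d := d) P 1 1 = 1 := by
  unfold tensor
  rw [Matrix.one_kronecker_one, Matrix.submatrix_one_equiv]

lemma trace_tensor (P : Finset V) (α : Op P d) (β : Op {v : V // v ∉ P} d) :
    (tensor P α β).trace = α.trace * β.trace := by
  rw [← Matrix.trace_kronecker]
  exact (splitConfig P d).sum_comp fun i => (α ⊗ₖ β) i i

/-- The embedding `α ↦ α ⊗ 1` of the operators on `P`. -/
def tensorLeft (d : ℕ) (P : Finset V) : Op P d →ₐ[ℂ] Op V d :=
  AlgHom.ofLinearMap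
    { toFun := fun α => tensor P α 1
      map_add' := fun α α' => by
        ext σ τ
        simp only [tensor_apply, Matrix.add_apply, add_mul]
      map_smul' := fun c α => by
        ext σ τ
        simp only [tensor_apply, Matrix.smul_apply, smul_mul_assoc, RingHom.id_apply] }
    (tensor_one_one P) fun α α' => by simp [tensor_mul]

lemma mem_range_tensorLeft {P : Finset V} {M : Op V d} :
    M ∈ (tensorLeft d P).range ↔ ∃ α, tensor P α 1 = M := Iff.rfl

/-- The embedding `β ↦ 1 ⊗ β` of the operators on the complement of `P`. -/
def tensorRight (d : ℕ) (P : Finset V) : Op {v : V // v ∉ P} d →ₐ[ℂ] Op V d :=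
  AlgHom.ofLinearMap
    { toFun := fun β => tensor P 1 β
      map_add' := fun β β' => by
        ext σ τ
        simp only [tensor_apply, Matrix.add_apply, mul_add]
      map_smul' := fun c β => by
        ext σ τ
        simp only [tensor_apply, Matrix.smul_apply, mul_smul_comm, RingHom.id_apply] }
    (tensor_one_one P) fun α α' => by simp [tensor_mul]

lemma mem_range_tensorRight {P : Finset V} {M : Op V d} :
    M ∈ (tensorRight d P).range ↔ ∃ β, tensor P 1 β = M := Iff.rfl

lemma ActsOn.mem_tensorLeft {A : Op V d} {X P : Finset V} (h : ActsOn A X) (hXP : X ⊆ P) :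
    A ∈ (tensorLeft d P).range := by
  classical
  obtain ⟨B, hB⟩ := h
  refine mem_range_tensorLeft.2 ⟨Matrix.of fun σ τ => if ∀ v : P, (v : V) ∉ X → σ v = τ v then
    B (fun v => σ ⟨v, hXP v.2⟩) (fun v => τ ⟨v, hXP v.2⟩) else 0, ?_⟩
  ext σ τ
  rw [tensor_apply, hB, Matrix.one_apply, Matrix.of_apply]
  split_ifs with h3 h2 h1 h1 h2 h1 h1
  · exact mul_one _
  · refine absurd (fun v hv => ?_) h1
    by_cases hvP : v ∈ P
    · exact h3 ⟨v, hvP⟩ hv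
    · exact congrFun h2 ⟨v, hvP⟩
  · exact absurd (funext fun v : {v : V // v ∉ P} => h1 v fun h => v.2 (hXP h)) h2
  · exact mul_zero _
  · exact absurd (fun (v : P) hv => h1 v hv) h3
  · exact zero_mul _
  · exact absurd (fun (v : P) hv => h1 v hv) h3
  · exact zero_mul _

lemma ActsOn.mem_tensorRight {A : Op V d} {X P : Finset V} (h : ActsOn A X)
    (hXP : Disjoint X P) : A ∈ (tensorRight d P).range := by
  classical
  obtain ⟨B, hB⟩ := h
  have hX : ∀ v ∈ X, v ∉ P := fun v hv hv' => Finset.disjoint_left.1 hXP hv hv'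
  refine mem_range_tensorRight.2 ⟨Matrix.of fun σ τ =>
    if ∀ v : {v : V // v ∉ P}, (v : V) ∉ X → σ v = τ v then
    B (fun v => σ ⟨v, hX v v.2⟩) (fun v => τ ⟨v, hX v v.2⟩) else 0, ?_⟩
  ext σ τ
  rw [tensor_apply, hB, Matrix.one_apply, Matrix.of_apply]
  split_ifs with h2 h3 h1 h1 h3 h1 h1
  · exact one_mul _
  · refine absurd (fun v hv => ?_) h1
    by_cases hvP : v ∈ P
    · exact congrFun h2 ⟨v, hvP⟩
    · exact h3 ⟨v, hvP⟩ hv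
  · exact absurd (fun (v : {v : V // v ∉ P}) hv => h1 v hv) h3
  · exact mul_zero _
  · exact absurd (funext fun v : P => h1 v fun h => hX v h v.2) h2
  · exact zero_mul _
  · exact absurd (funext fun v : P => h1 v fun h => hX v h v.2) h2
  · exact zero_mul _

lemma commute_of_mem_range_tensor {P : Finset V} {M N : Op V d} (hM : M ∈ (tensorLeft d P).range)
    (hN : N ∈ (tensorRight d P).range) : Commute M N := by
  obtain ⟨α, rfl⟩ := mem_range_tensorLeft.1 hM
  obtain ⟨β, rfl⟩ := mem_range_tensorRight.1 hN
  rw [Commute, SemiconjBy, tensor_mul, tensor_mul]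
  simp

lemma ActsOn.smul {A : Op V d} {X : Finset V} (h : ActsOn A X) (c : ℂ) : ActsOn (c • A) X := by
  obtain ⟨B, hB⟩ := h
  refine ⟨c • B, fun σ τ => ?_⟩
  rw [Matrix.smul_apply, hB]
  split_ifs <;> simp

lemma exp_mem_subalgebra {n : Type*} [Fintype n] [DecidableEq n] (K : Subalgebra ℂ (Matrix n n ℂ))
    {M : Matrix n n ℂ} (h : M ∈ K) : NormedSpace.exp M ∈ K :=
  NormedSpace.exp_mem (R := ℂ) (s := K)
    (Submodule.closed_of_finiteDimensional (Subalgebra.toSubmodule K)) h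

lemma IsProductState.posSemidef {ρ : Op V d} (hρ : IsProductState ρ) : ρ.PosSemidef := by
  obtain ⟨r, hr, h⟩ := hρ
  choose B hB using fun v => exists_eq_conjTranspose_mul_self (hr v).1
  suffices h' : ρ = (Matrix.of fun σ τ : Config V d => ∏ v, B v (σ v) (τ v))ᴴ *
      Matrix.of fun σ τ : Config V d => ∏ v, B v (σ v) (τ v) from
    h' ▸ Matrix.posSemidef_conjTranspose_mul_self _
  ext σ τ
  rw [h, Matrix.mul_apply]
  simp only [Matrix.conjTranspose_apply, Matrix.of_apply, star_prod, ← Finset.prod_mul_distrib]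
  rw [← Fintype.prod_sum fun v j => star (B v j (σ v)) * B v j (τ v)]
  refine Finset.prod_congr rfl fun v _ => ?_
  rw [hB v, Matrix.mul_apply]
  rfl

lemma IsProductState.trace_eq_one {ρ : Op V d} (hρ : IsProductState ρ) : ρ.trace = 1 := by
  obtain ⟨r, hr, h⟩ := hρ
  simp only [Matrix.trace, Matrix.diag_apply, h]
  rw [← Fintype.prod_sum fun v j => r v j j]
  exact Finset.prod_eq_one fun v _ => (hr v).2

/-- A product state restricts to product states on `P` and its complement. -/
lemma IsProductState.exists_tensor {ρ : Op V d} (hρ : IsProductState ρ) (P : Finset V) :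
    ∃ (α : Op P d) (β : Op {v : V // v ∉ P} d), α.trace = 1 ∧ β.trace = 1 ∧ ρ = tensor P α β := by
  obtain ⟨r, hr, h⟩ := hρ
  refine ⟨Matrix.of fun σ τ => ∏ v : P, r v (σ v) (τ v),
    Matrix.of fun σ τ => ∏ v : {v : V // v ∉ P}, r v (σ v) (τ v),
    IsProductState.trace_eq_one ⟨fun v => r v, fun v => hr v, fun _ _ => rfl⟩,
    IsProductState.trace_eq_one ⟨fun v => r v, fun v => hr v, fun _ _ => rfl⟩, ?_⟩
  ext σ τ
  rw [h, tensor_apply, Matrix.of_apply, Matrix.of_apply]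
  convert! (Fintype.prod_subtype_mul_prod_subtype (· ∈ P) fun v => r v (σ v) (τ v)).symm

/-- Operators on complementary regions are independent in a product state. -/
lemma IsProductState.trace_mul_mul {ρ : Op V d} (hρ : IsProductState ρ) {P : Finset V}
    {M N : Op V d} (hM : M ∈ (tensorLeft d P).range) (hN : N ∈ (tensorRight d P).range) :
    (ρ * (M * N)).trace = (ρ * M).trace * (ρ * N).trace := by
  obtain ⟨r, r', h1, h2, rfl⟩ := hρ.exists_tensor P
  obtain ⟨α, rfl⟩ := mem_range_tensorLeft.1 hM
  obtain ⟨β, rfl⟩ := mem_range_tensorRight.1 hN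
  simp [tensor_mul, trace_tensor, h1, h2]

/-- The product `e^{p_A} e^{q_A} e^{r_A}` of exponentials of the local sums `p_A = ∑_{X ∈ A} p_X`
and so on. -/
noncomputable def tripleExp {ι : Type*} (p q r : ι → Op V d) (A : Finset ι) : Op V d :=
  NormedSpace.exp (∑ X ∈ A, p X) * NormedSpace.exp (∑ X ∈ A, q X) *
    NormedSpace.exp (∑ X ∈ A, r X)

/-- Expectations of the exponentials factorize between families of terms with disjoint supports:
each factor `e^{p_{A ∪ B}}` splits, and the parts belonging to `A` commute with those of `B`. -/
lemma IsProductState.trace_tripleExp_union {ρ : Op V d} (hρ : IsProductState ρ) {ι : Type*}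
    [DecidableEq ι] {p q r : ι → Op V d} (supp : ι → Finset V)
    (hp : ∀ X, ActsOn (p X) (supp X)) (hq : ∀ X, ActsOn (q X) (supp X))
    (hr : ∀ X, ActsOn (r X) (supp X)) {A B : Finset ι} (hAB : Disjoint A B)
    (h : ∀ X ∈ A, ∀ Y ∈ B, Disjoint (supp X) (supp Y)) :
    (ρ * tripleExp p q r (A ∪ B)).trace =
      (ρ * tripleExp p q r A).trace * (ρ * tripleExp p q r B).trace := by
  let P := A.biUnion supp
  have hL : ∀ f : ι → Op V d, (∀ X, ActsOn (f X) (supp X)) →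
      NormedSpace.exp (∑ X ∈ A, f X) ∈ (tensorLeft d P).range ∧
      NormedSpace.exp (∑ X ∈ B, f X) ∈ (tensorRight d P).range ∧
      NormedSpace.exp (∑ X ∈ A ∪ B, f X) =
        NormedSpace.exp (∑ X ∈ A, f X) * NormedSpace.exp (∑ X ∈ B, f X) := by
    intro f hf
    have h1 : ∑ X ∈ A, f X ∈ (tensorLeft d P).range := sum_mem fun X hX =>
      (hf X).mem_tensorLeft (Finset.subset_biUnion_of_mem supp hX)
    have h2 : ∑ X ∈ B, f X ∈ (tensorRight d P).range := sum_mem fun Y hY =>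
      (hf Y).mem_tensorRight
        ((Finset.disjoint_biUnion_right _ _ _).2 fun X hX => (h X hX Y hY).symm)
    refine ⟨exp_mem_subalgebra _ h1, exp_mem_subalgebra _ h2, ?_⟩
    rw [Finset.sum_union hAB, Matrix.exp_add_of_commute _ _ (commute_of_mem_range_tensor h1 h2)]
  obtain ⟨p1, p2, p3⟩ := hL p hp
  obtain ⟨q1, q2, q3⟩ := hL q hq
  obtain ⟨r1, r2, r3⟩ := hL r hr
  unfold tripleExp
  rw [← hρ.trace_mul_mul (mul_mem (mul_mem p1 q1) r1) (mul_mem (mul_mem p2 q2) r2), p3, q3, r3]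
  have c1 := (commute_of_mem_range_tensor q1 p2).eq
  have c2 := (commute_of_mem_range_tensor r1 (mul_mem p2 q2)).eq
  congr 2
  generalize NormedSpace.exp (∑ X ∈ A, p X) = a at *
  generalize NormedSpace.exp (∑ X ∈ A, q X) = b at *
  generalize NormedSpace.exp (∑ X ∈ A, r X) = c at *
  generalize NormedSpace.exp (∑ X ∈ B, p X) = a' at *
  generalize NormedSpace.exp (∑ X ∈ B, q X) = b' at *
  generalize NormedSpace.exp (∑ X ∈ B, r X) = c' at *
  calc a * a' * (b * b') * (c * c') = a * (a' * b) * (b' * c) * c' := by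
        simp only [Matrix.mul_assoc]
    _ = a * b * (a' * b' * c) * c' := by rw [← c1]; simp only [Matrix.mul_assoc]
    _ = a * b * c * (a' * b' * c') := by rw [← c2]; simp only [Matrix.mul_assoc]

/-- The Möbius transform of the expectations is bounded by that of the scalar function
`e^{(s₁ + s₂ + s₃) |A|}`, which majorizes the product of exponentials. -/
lemma norm_setDiff_trace_tripleExp_le {ρ : Op V d} (hρ : IsProductState ρ) {ι : Type*}
    [DecidableEq ι] [Fintype ι] {p q r : ι → Op V d} {s₁ s₂ s₃ : ℝ}
    (hp : ∀ X, ‖p X‖ ≤ s₁) (hq : ∀ X, ‖q X‖ ≤ s₂) (hr : ∀ X, ‖r X‖ ≤ s₃) (D : Finset ι) :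
    ‖setDiff D (fun A => (ρ * tripleExp p q r A).trace) ∅‖ ≤
      (Real.exp (s₁ + s₂ + s₃) - 1) ^ D.card := by
  let f : Op V d →+ ℂ := (Matrix.traceAddMonoidHom (Config V d) ℂ).comp (AddMonoidHom.mulLeft ρ)
  have h1 : setDiff D (fun A => (ρ * tripleExp p q r A).trace) ∅ =
      (ρ * setDiff D (tripleExp p q r) ∅).trace := setDiff_map f D (tripleExp p q r) ∅
  have := nonempty_of_trace_eq_one hρ.trace_eq_one
  have h2 := (((majorizedOn_sum_of_norm_le D hp).exp.mul (majorizedOn_sum_of_norm_le D hq).exp).mul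
    (majorizedOn_sum_of_norm_le D hr).exp) D subset_rfl ∅
  rw [h1]
  refine (norm_trace_mul_le hρ.posSemidef hρ.trace_eq_one _).trans (h2.trans_eq ?_)
  simp only [← Real.exp_add, ← add_mul]
  rw [setDiff_exp_card _ _ _ (Finset.disjoint_empty_right _)]
  simp

end Regions

/-! ### Projective measurements -/

section Measurement

open Matrix
open scoped Matrix.Norms.L2Operator ComplexOrder

variable {V : Type*} [Fintype V] [DecidableEq V] {d : ℕ}

lemma exp_mulVec_of_mulVec_eq_smul {n : Type*} [Fintype n] [DecidableEq n] {M : Matrix n n ℂ}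
    {v : n → ℂ} {μ : ℂ} (h : M *ᵥ v = μ • v) :
    NormedSpace.exp M *ᵥ v = Complex.exp μ • v := by
  have hpow : ∀ k : ℕ, M ^ k *ᵥ v = μ ^ k • v := by
    intro k
    induction k with
    | zero => simp
    | succ k ih =>
      rw [pow_succ, ← Matrix.mulVec_mulVec, h, Matrix.mulVec_smul, ih, smul_smul, pow_succ,
        mul_comm]
  have h1 := (NormedSpace.exp_series_hasSum_exp' (𝕂 := ℂ) M).map
    ((Matrix.mulVecBilin ℂ ℂ).flip v : Matrix n n ℂ →ₗ[ℂ] n → ℂ)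
    (LinearMap.continuous_of_finiteDimensional _)
  have h2 := (NormedSpace.exp_series_hasSum_exp' (𝕂 := ℂ) μ).smul_const v
  rw [← Complex.exp_eq_exp_ℂ] at h2
  refine HasSum.unique h1 ?_
  convert h2 using 2 with k
  simp [hpow, smul_smul]

lemma eigenProjector_posSemidef (A : Op V d) (x : ℝ) : (eigenProjector A x).PosSemidef := by
  have h1 : eigenProjector A x * eigenProjector A x = eigenProjector A x := by
    unfold eigenProjector
    rw [← map_mul]
    congr 1
    exact (Submodule.isIdempotentElem_starProjection _).eq
  have h2 : (eigenProjector A x)ᴴ = eigenProjector A x := by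
    unfold eigenProjector
    rw [← Matrix.star_eq_conjTranspose]
    refine ((Matrix.toEuclideanCLM (n := Config V d) (𝕜 := ℂ)).symm.map_star' _).symm.trans ?_
    rw [(isSelfAdjoint_starProjection _).star_eq]
    rfl
  rw [← h1]
  nth_rewrite 1 [← h2]
  exact Matrix.posSemidef_conjTranspose_mul_self _

lemma outcomeProb_nonneg {ρ : Op V d} (hρ : ρ.PosSemidef) (A : Op V d) (x : ℝ) :
    0 ≤ outcomeProb ρ A x := by
  obtain ⟨B, hB⟩ := exists_eq_conjTranspose_mul_self (eigenProjector_posSemidef A x)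
  unfold outcomeProb
  rw [hB, Matrix.mul_assoc, Matrix.trace_mul_comm]
  exact (Complex.le_def.1 (hρ.mul_mul_conjTranspose_same B).trace_nonneg).1

/-- Spectral decomposition of the exponential, `e^{τ A} = ∑ₓ e^{τ x} Π(x)`. -/
lemma sum_exp_smul_eigenProjector {A : Op V d} (hA : A.IsHermitian) (τ : ℝ) :
    ∑ x ∈ outcomes A, Complex.exp (τ * x) • eigenProjector A x =
      NormedSpace.exp ((τ : ℂ) • A) := by
  let T := Matrix.toEuclideanCLM (n := Config V d) (𝕜 := ℂ)
  have hsymm := Matrix.isSymmetric_toEuclideanLin_iff.2 hA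
  have hmem : ∀ j, hA.eigenvectorBasis j ∈
      Module.End.eigenspace (Matrix.toEuclideanLin A) ((hA.eigenvalues j : ℝ) : ℂ) := by
    intro j
    rw [Module.End.mem_eigenspace_iff]
    apply (WithLp.equiv 2 (Config V d → ℂ)).injective
    exact hA.mulVec_eigenvectorBasis j
  apply EquivLike.injective T
  rw [map_sum]
  apply ContinuousLinearMap.coe_injective
  refine hA.eigenvectorBasis.toBasis.ext fun j => ?_
  have hproj : ∀ x : ℝ, T (eigenProjector A x) (hA.eigenvectorBasis j) =
      if x = hA.eigenvalues j then hA.eigenvectorBasis j else 0 := by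
    intro x
    have e1 : T (eigenProjector A x) =
        (Module.End.eigenspace (Matrix.toEuclideanLin A) (x : ℂ)).starProjection :=
      T.apply_symm_apply _
    rw [e1]
    split_ifs with hx
    · rw [Submodule.starProjection_eq_self_iff, hx]
      exact hmem j
    · rw [Submodule.starProjection_apply_eq_zero_iff, Submodule.mem_orthogonal]
      intro u hu
      exact hsymm.orthogonalFamily_eigenspaces (i := (x : ℂ)) (j := (hA.eigenvalues j : ℂ))
        (by exact_mod_cast hx) ⟨u, hu⟩ ⟨_, hmem j⟩
  have hout : hA.eigenvalues j ∈ outcomes A := by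
    simp [outcomes, hA.eigenvalues_mem_spectrum_real j]
  simp only [OrthonormalBasis.coe_toBasis, ContinuousLinearMap.coe_coe,
    _root_.sum_apply, map_smul, _root_.smul_apply, hproj, smul_ite,
    smul_zero]
  rw [Finset.sum_ite_eq' (outcomes A), if_pos hout]
  apply (WithLp.equiv 2 (Config V d → ℂ)).injective
  refine (exp_mulVec_of_mulVec_eq_smul ?_).symm
  change ((τ : ℂ) • A) *ᵥ (hA.eigenvectorBasis j).ofLp = _
  rw [Matrix.smul_mulVec, hA.mulVec_eigenvectorBasis, mul_smul]
  rfl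

lemma sum_exp_mul_outcomeProb {A : Op V d} (hA : A.IsHermitian) (ρ : Op V d) (τ : ℝ) :
    ∑ x ∈ outcomes A, Real.exp (τ * x) * outcomeProb ρ A x =
      (ρ * NormedSpace.exp ((τ : ℂ) • A)).trace.re := by
  rw [← sum_exp_smul_eigenProjector hA, Matrix.mul_sum, Matrix.trace_sum, Complex.re_sum]
  refine Finset.sum_congr rfl fun x _ => ?_
  rw [Matrix.mul_smul, Matrix.trace_smul, Matrix.trace_mul_comm, smul_eq_mul, ← Complex.ofReal_mul,
    ← Complex.ofReal_exp, Complex.re_ofReal_mul]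
  rfl

/-- The two-sided Chernoff bound for a projective measurement. -/
lemma deviationProb_le_of_mgf_le {A : Op V d} (hA : A.IsHermitian) {ρ : Op V d}
    (hρ : ρ.PosSemidef) {τ K δ : ℝ} (hτ : 0 ≤ τ)
    (h₁ : (ρ * NormedSpace.exp ((τ : ℂ) • A)).trace.re ≤ Real.exp (τ * mean ρ A + K))
    (h₂ : (ρ * NormedSpace.exp (((-τ : ℝ) : ℂ) • A)).trace.re ≤ Real.exp (-τ * mean ρ A + K)) :
    deviationProb ρ A δ ≤ 2 * Real.exp (K - τ * δ) := by
  rw [← sum_exp_mul_outcomeProb hA] at h₁ h₂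
  set m := mean ρ A with hm
  calc deviationProb ρ A δ
      ≤ ∑ x ∈ outcomes A with δ ≤ |x - m|,
          (Real.exp (-τ * m - τ * δ) * (Real.exp (τ * x) * outcomeProb ρ A x) +
            Real.exp (τ * m - τ * δ) * (Real.exp (-τ * x) * outcomeProb ρ A x)) := by
        refine Finset.sum_le_sum fun x hx => ?_
        have hx' := (Finset.mem_filter.1 hx).2
        have hp := outcomeProb_nonneg hρ A x
        rw [← mul_assoc, ← mul_assoc, ← Real.exp_add, ← Real.exp_add, ← add_mul]
        refine le_mul_of_one_le_left hp ?_
        rcases le_abs.1 hx' with h | h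
        · refine le_add_of_le_of_nonneg (Real.one_le_exp ?_) (Real.exp_pos _).le
          nlinarith
        · refine le_add_of_nonneg_of_le (Real.exp_pos _).le (Real.one_le_exp ?_)
          nlinarith
    _ ≤ ∑ x ∈ outcomes A,
          (Real.exp (-τ * m - τ * δ) * (Real.exp (τ * x) * outcomeProb ρ A x) +
            Real.exp (τ * m - τ * δ) * (Real.exp (-τ * x) * outcomeProb ρ A x)) := by
        refine Finset.sum_le_sum_of_subset_of_nonneg (Finset.filter_subset _ _) fun x _ _ => ?_
        have hp := outcomeProb_nonneg hρ A x
        positivity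
    _ ≤ Real.exp (-τ * m - τ * δ) * Real.exp (τ * m + K) +
          Real.exp (τ * m - τ * δ) * Real.exp (-τ * m + K) := by
        rw [Finset.sum_add_distrib, ← Finset.mul_sum, ← Finset.mul_sum]
        gcongr
    _ = 2 * Real.exp (K - τ * δ) := by
        rw [← Real.exp_add, ← Real.exp_add, two_mul]
        congr 2 <;> ring

/-- Outcomes never deviate from the mean by more than `2 ‖A‖`. -/
lemma deviationProb_eq_zero {A ρ : Op V d} (hρ : ρ.PosSemidef) (h1 : ρ.trace = 1) {δ : ℝ}
    (hδ : 2 * ‖A‖ < δ) : deviationProb ρ A δ = 0 := by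
  have := nonempty_of_trace_eq_one h1
  unfold deviationProb
  rw [Finset.filter_false_of_mem, Finset.sum_empty]
  intro x hx
  have hx1 : x ∈ spectrum ℝ A := by simpa [outcomes] using hx
  have hx2 : ‖(x : ℂ)‖ ≤ ‖A‖ :=
    spectrum.norm_le_norm_of_mem ((spectrum.algebraMap_mem_iff ℂ).2 hx1)
  rw [Complex.norm_real, Real.norm_eq_abs] at hx2
  have hm : |mean ρ A| ≤ ‖A‖ :=
    (Complex.abs_re_le_norm _).trans (norm_trace_mul_le hρ h1 A)
  have := abs_sub x (mean ρ A)
  linarith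

lemma evolve_posSemidef {H ρ : Op V d} (hH : H.IsHermitian) (hρ : ρ.PosSemidef) (t : ℝ) :
    (evolve H t ρ).PosSemidef := by
  have h : NormedSpace.exp ((Complex.I * (t : ℂ)) • H) =
      (NormedSpace.exp ((-(Complex.I * (t : ℂ))) • H))ᴴ := by
    rw [← Matrix.exp_conjTranspose, Matrix.conjTranspose_smul, hH.eq]
    simp
  unfold evolve
  rw [h]
  exact hρ.mul_mul_conjTranspose_same _

lemma exp_smul_mul_exp_neg_smul (H : Op V d) (c : ℂ) :
    NormedSpace.exp (c • H) * NormedSpace.exp ((-c) • H) = 1 := by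
  rw [← Matrix.exp_add_of_commute _ _ (((Commute.refl H).smul_left c).smul_right (-c)), ← add_smul]
  simp

/-- Passing from the evolved state to the evolved observable. -/
lemma trace_evolve_mul (H ρ M : Op V d) (t : ℝ) :
    (evolve H t ρ * M).trace = (ρ * (NormedSpace.exp ((Complex.I * (t : ℂ)) • H) * M *
      NormedSpace.exp ((-(Complex.I * (t : ℂ))) • H))).trace := by
  unfold evolve
  rw [Matrix.mul_assoc, Matrix.mul_assoc, Matrix.trace_mul_comm]
  simp only [Matrix.mul_assoc]

lemma trace_evolve (H ρ : Op V d) (t : ℝ) : (evolve H t ρ).trace = ρ.trace := by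
  have h := trace_evolve_mul H ρ 1 t
  rwa [Matrix.mul_one, Matrix.mul_one, exp_smul_mul_exp_neg_smul, Matrix.mul_one] at h

end Measurement

/-! ### Analytic logarithms and their second-order expansion -/

section Analytic

open Metric

/-- A quadratic Taylor estimate, from the Schwarz lemma applied to `φ` and then to `φ z / z`. -/
lemma norm_sub_deriv_mul_le {φ : ℂ → ℂ} {r M : ℝ} (hr : 0 < r)
    (hd : DifferentiableOn ℂ φ (ball 0 r)) (h0 : φ 0 = 0) (hM : ∀ z ∈ ball (0 : ℂ) r, ‖φ z‖ ≤ M)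
    {z : ℂ} (hz : z ∈ ball (0 : ℂ) r) : ‖φ z - z * deriv φ 0‖ ≤ 2 * M / r ^ 2 * ‖z‖ ^ 2 := by
  have hmaps : Set.MapsTo φ (ball 0 r) (closedBall (φ 0) M) := fun w hw => by
    rw [mem_closedBall, h0, dist_zero_right]; exact hM w hw
  have h1 : ∀ w ∈ ball (0 : ℂ) r, ‖dslope φ 0 w‖ ≤ M / r := fun w hw =>
    Complex.norm_dslope_le_div_of_mapsTo_ball hd hmaps hw
  have hd' : DifferentiableOn ℂ (dslope φ 0) (ball 0 r) :=
    (Complex.differentiableOn_dslope (ball_mem_nhds 0 hr)).2 hd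
  have hmaps' : Set.MapsTo (dslope φ 0) (ball 0 r) (closedBall (dslope φ 0 0) (2 * (M / r))) :=
    fun w hw => by
      rw [mem_closedBall, dist_eq_norm]
      have := norm_sub_le (dslope φ 0 w) (dslope φ 0 0)
      have := h1 w hw
      have := h1 0 (mem_ball_self hr)
      linarith
  have h2 := Complex.dist_le_div_mul_dist_of_mapsTo_ball hd' hmaps' hz
  rw [dslope_same, dist_eq_norm, dist_zero_right] at h2
  have h3 : φ z = z * dslope φ 0 z := by
    have := sub_smul_dslope φ 0 z
    rw [h0, sub_zero, sub_zero, smul_eq_mul] at this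
    exact this.symm
  rw [h3, ← mul_sub, norm_mul]
  calc ‖z‖ * ‖dslope φ 0 z - deriv φ 0‖ ≤ ‖z‖ * (2 * (M / r) / r * ‖z‖) := by gcongr
    _ = _ := by field_simp

/-- A telescoping product of ratios close to `1` has an analytic logarithm, of norm at most the
number of factors. -/
lemma exists_log {ι : Type*} [DecidableEq ι] {F : Finset ι → ℂ → ℂ} {r ε : ℝ}
    (hd : ∀ A, DifferentiableOn ℂ (F A) (ball 0 r)) (h1 : ∀ z, F ∅ z = 1) (h0 : ∀ A, F A 0 = 1)
    (hε : ε ≤ 1 / 3)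
    (h : ∀ z ∈ ball (0 : ℂ) r, ∀ X A, X ∉ A → ‖F (insert X A) z - F A z‖ ≤ ε * ‖F A z‖)
    (A : Finset ι) :
    ∃ φ : ℂ → ℂ, DifferentiableOn ℂ φ (ball 0 r) ∧ φ 0 = 0 ∧
      (∀ z ∈ ball (0 : ℂ) r, Complex.exp (φ z) = F A z) ∧
      ∀ z ∈ ball (0 : ℂ) r, ‖φ z‖ ≤ A.card := by
  induction A using Finset.induction_on with
  | empty => exact ⟨fun _ => 0, differentiableOn_const _, rfl, by simp [h1], by simp⟩
  | insert X A hX ih =>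
    obtain ⟨φ, hφd, hφ0, hφe, hφn⟩ := ih
    have hne : ∀ z ∈ ball (0 : ℂ) r, F A z ≠ 0 := fun z hz => hφe z hz ▸ Complex.exp_ne_zero _
    have hu : ∀ z ∈ ball (0 : ℂ) r, ‖F (insert X A) z / F A z - 1‖ ≤ 1 / 3 := fun z hz => by
      rw [div_sub_one (hne z hz), norm_div, div_le_iff₀ (norm_pos_iff.2 (hne z hz))]
      exact (h z hz X A hX).trans (by gcongr)
    have hslit : ∀ z ∈ ball (0 : ℂ) r, F (insert X A) z / F A z ∈ Complex.slitPlane :=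
      fun z hz => by
        have := Complex.mem_slitPlane_of_norm_lt_one ((hu z hz).trans_lt (by norm_num))
        rwa [add_sub_cancel] at this
    refine ⟨fun z => φ z + Complex.log (F (insert X A) z / F A z),
      hφd.add (((hd _).div (hd A) hne).clog hslit), ?_, fun z hz => ?_, fun z hz => ?_⟩
    · simp [hφ0, h0]
    · rw [Complex.exp_add, hφe z hz, Complex.exp_log (Complex.slitPlane_ne_zero (hslit z hz)),
        mul_div_cancel₀ _ (hne z hz)]
    · have h3 := Complex.norm_log_one_add_half_le_self
        ((hu z hz).trans (by norm_num : (1 : ℝ) / 3 ≤ 1 / 2))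
      rw [add_sub_cancel] at h3
      rw [Finset.card_insert_of_notMem hX]
      push_cast
      refine (norm_add_le _ _).trans (add_le_add (hφn z hz) ?_)
      have := hu z hz
      linarith

end Analytic

/-! ### The moment generating function at short times -/

section ShortTime

open Matrix Metric
open scoped Matrix.Norms.L2Operator

variable {V : Type*} [Fintype V] [DecidableEq V] {d k : ℕ} {S : Finset (Finset V)}

lemma LocalHamiltonian.isHermitian_toOp (H : LocalHamiltonian d k S) : H.toOp.IsHermitian :=
  isSelfAdjoint_sum _ fun X _ => by
    rw [isSelfAdjoint_iff, star_smul, Matrix.star_eq_conjTranspose, (H.isHermitian_term X).eq]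
    simp

lemma LocalHamiltonian.norm_smul_term_le (H : LocalHamiltonian d k S) (c : ℂ) (X : S) :
    ‖c • (H.coeff X : ℂ) • H.term X‖ ≤ ‖c‖ := by
  have h1 : ‖H.term X‖ = 1 := H.norm_term X
  rw [norm_smul, norm_smul, h1, mul_one, Complex.norm_real, Real.norm_eq_abs]
  exact mul_le_of_le_one_right (norm_nonneg _) (H.abs_coeff_le X)

lemma LocalHamiltonian.actsOn_smul_term (H : LocalHamiltonian d k S) (c : ℂ) (X : S) :
    ActsOn (c • (H.coeff X : ℂ) • H.term X) X :=
  ((H.hasSupport_term X).1.smul _).smul _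

lemma LocalHamiltonian.norm_toOp_le (H : LocalHamiltonian d k S) : ‖H.toOp‖ ≤ S.card := by
  refine (norm_sum_le_of_le (f := fun X => (H.coeff X : ℂ) • H.term X) Finset.univ
    fun X _ => by simpa using H.norm_smul_term_le 1 X).trans ?_
  simp

lemma hasDerivAt_trace_mul_exp {n : Type*} [Fintype n] [DecidableEq n] (ρ a c W : Matrix n n ℂ)
    (z : ℂ) :
    HasDerivAt (fun z : ℂ => (ρ * (a * NormedSpace.exp (z • W) * c)).trace)
      (ρ * (a * (NormedSpace.exp (z • W) * W) * c)).trace z := by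
  let f : Matrix n n ℂ →ₗ[ℂ] ℂ := Matrix.traceLinearMap n ℂ ℂ ∘ₗ LinearMap.mulLeft ℂ ρ ∘ₗ
    LinearMap.mulRight ℂ c ∘ₗ LinearMap.mulLeft ℂ a
  exact (LinearMap.toContinuousLinearMap f).hasFDerivAt.comp_hasDerivAt z
    (hasDerivAt_exp_smul_const W z)

/-- The partition function `tr (ρ e^{itH₁} e^{zH₂} e^{-itH₁})` of the subsystems in `A`. -/
noncomputable def partitionFunction (H₁ H₂ : LocalHamiltonian d k S) (ρ : Op V d) (t : ℝ)
    (A : Finset S) (z : ℂ) : ℂ :=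
  (ρ * tripleExp (fun X => (Complex.I * (t : ℂ)) • (H₁.coeff X : ℂ) • H₁.term X)
    (fun X => z • (H₂.coeff X : ℂ) • H₂.term X)
    (fun X => (-(Complex.I * (t : ℂ))) • (H₁.coeff X : ℂ) • H₁.term X) A).trace

lemma partitionFunction_eq (H₁ H₂ : LocalHamiltonian d k S) (ρ : Op V d) (t : ℝ)
    (A : Finset S) (z : ℂ) :
    partitionFunction H₁ H₂ ρ t A z =
      (ρ * (NormedSpace.exp ((Complex.I * (t : ℂ)) • ∑ X ∈ A, (H₁.coeff X : ℂ) • H₁.term X) *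
        NormedSpace.exp (z • ∑ X ∈ A, (H₂.coeff X : ℂ) • H₂.term X) *
        NormedSpace.exp
          ((-(Complex.I * (t : ℂ))) • ∑ X ∈ A, (H₁.coeff X : ℂ) • H₁.term X))).trace := by
  simp only [partitionFunction, tripleExp, Finset.smul_sum]

lemma differentiable_partitionFunction (H₁ H₂ : LocalHamiltonian d k S) (ρ : Op V d) (t : ℝ)
    (A : Finset S) : Differentiable ℂ (partitionFunction H₁ H₂ ρ t A) := by
  simp only [funext (partitionFunction_eq H₁ H₂ ρ t A)]
  exact fun z => (hasDerivAt_trace_mul_exp _ _ _ _ z).differentiableAt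

lemma partitionFunction_empty (H₁ H₂ : LocalHamiltonian d k S) {ρ : Op V d} (hρ : ρ.trace = 1)
    (t : ℝ) (z : ℂ) : partitionFunction H₁ H₂ ρ t ∅ z = 1 := by
  simp [partitionFunction_eq, hρ]

lemma partitionFunction_zero (H₁ H₂ : LocalHamiltonian d k S) {ρ : Op V d} (hρ : ρ.trace = 1)
    (t : ℝ) (A : Finset S) : partitionFunction H₁ H₂ ρ t A 0 = 1 := by
  rw [partitionFunction_eq, zero_smul, NormedSpace.exp_zero, Matrix.mul_one,
    exp_smul_mul_exp_neg_smul, Matrix.mul_one, hρ]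

lemma partitionFunction_univ (H₁ H₂ : LocalHamiltonian d k S) (ρ : Op V d) (t : ℝ) (z : ℂ) :
    partitionFunction H₁ H₂ ρ t Finset.univ z =
      (evolve H₁.toOp t ρ * NormedSpace.exp (z • H₂.toOp)).trace := by
  rw [partitionFunction_eq, trace_evolve_mul]
  rfl

lemma hasDerivAt_partitionFunction_univ (H₁ H₂ : LocalHamiltonian d k S) (ρ : Op V d) (t : ℝ) :
    HasDerivAt (partitionFunction H₁ H₂ ρ t Finset.univ)
      (evolve H₁.toOp t ρ * H₂.toOp).trace 0 := by
  have h := hasDerivAt_trace_mul_exp (evolve H₁.toOp t ρ) 1 1 H₂.toOp 0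
  simp only [zero_smul, NormedSpace.exp_zero, Matrix.one_mul, Matrix.mul_one] at h
  rwa [← funext (partitionFunction_univ H₁ H₂ ρ t)] at h

lemma partitionFunction_union (H₁ H₂ : LocalHamiltonian d k S) {ρ : Op V d}
    (hρ : IsProductState ρ) (t : ℝ) (z : ℂ) {A B : Finset S} (hAB : Disjoint A B)
    (h : ∀ X ∈ A, ∀ Y ∈ B, ¬ (interactionGraph S).Adj X Y) :
    partitionFunction H₁ H₂ ρ t (A ∪ B) z =
      partitionFunction H₁ H₂ ρ t A z * partitionFunction H₁ H₂ ρ t B z := by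
  refine hρ.trace_tripleExp_union (fun X : S => (X : Finset V)) (fun X => H₁.actsOn_smul_term _ X)
    (fun X => H₂.actsOn_smul_term _ X) (fun X => H₁.actsOn_smul_term _ X) hAB fun X hX Y hY => ?_
  rw [Finset.disjoint_iff_inter_eq_empty, ← Finset.not_nonempty_iff_eq_empty]
  exact fun hne => h X hX Y hY ⟨Finset.disjoint_iff_ne.1 hAB X hX Y hY, hne⟩

omit [Fintype V] in
/-- The smallness condition of the exploration argument at times up to `9/7` of the threshold, with
`a = 1 + 1/𝔡`, for which `a ^ 𝔡 ≤ e`. -/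
lemma exp_sub_one_mul_pow_le (hS : 1 ≤ interactionDegree S) {s : ℝ} (h0 : 0 ≤ s)
    (hs : s ≤ 9 / 7 * thresholdTime S) :
    (Real.exp s - 1) * (1 + 1 / (interactionDegree S : ℝ)) ^ interactionDegree S ≤
      1 / (3 * interactionDegree S) := by
  have hn : (1 : ℝ) ≤ interactionDegree S := by exact_mod_cast hS
  unfold thresholdTime at hs
  generalize interactionDegree S = n at *
  have he : 2.7182818283 < Real.exp 1 := Real.exp_one_gt_d9
  have hn0 : (0 : ℝ) < n := by linarith
  have hT : s ≤ 9 / 28 / (Real.exp 1 ^ 2 * n) := by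
    refine hs.trans ?_
    rw [mul_one_div, div_le_div_iff₀ (by positivity) (by positivity)]
    have : 0 ≤ Real.exp 1 ^ 2 * n * (n - 1) := by
      have : 0 ≤ (n : ℝ) - 1 := by linarith
      positivity
    nlinarith
  have hs1 : s ≤ 1 := by
    refine hT.trans ((div_le_one (by positivity)).2 ?_)
    nlinarith
  have h1 : Real.exp s - 1 ≤ 2 * s := by
    have := Real.abs_exp_sub_one_le (x := s) (by rwa [abs_of_nonneg h0])
    rw [abs_of_nonneg h0] at this
    exact (le_abs_self _).trans this
  have h2 : (1 + 1 / (n : ℝ)) ^ n ≤ Real.exp 1 := by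
    have h3 : 1 + 1 / (n : ℝ) ≤ Real.exp (1 / n) := by
      rw [add_comm]; exact Real.add_one_le_exp _
    refine (pow_le_pow_left₀ (by positivity) h3 n).trans_eq ?_
    rw [← Real.exp_nat_mul, mul_one_div_cancel hn0.ne']
  calc (Real.exp s - 1) * (1 + 1 / (n : ℝ)) ^ n ≤ 2 * s * Real.exp 1 := by gcongr
    _ ≤ 2 * (9 / 28 / (Real.exp 1 ^ 2 * n)) * Real.exp 1 := by gcongr
    _ = 9 / (14 * Real.exp 1 * n) := by field_simp; norm_num
    _ ≤ 1 / (3 * n) := by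
        rw [div_le_div_iff₀ (by positivity) (by positivity)]
        nlinarith

/-- Adding one subsystem changes the partition function by a relative amount at most `1 / (3𝔡)`. -/
lemma norm_partitionFunction_insert_sub_le (hS : 1 ≤ interactionDegree S)
    (H₁ H₂ : LocalHamiltonian d k S) {ρ : Op V d} (hρ : IsProductState ρ) {t : ℝ}
    (ht : |t| ≤ thresholdTime S / 7) {z : ℂ} (hz : ‖z‖ ≤ thresholdTime S) (X : S) (A : Finset S)
    (hX : X ∉ A) :
    ‖partitionFunction H₁ H₂ ρ t (insert X A) z - partitionFunction H₁ H₂ ρ t A z‖ ≤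
      1 / (3 * interactionDegree S) * ‖partitionFunction H₁ H₂ ρ t A z‖ := by
  classical
  have hn : (1 : ℝ) ≤ interactionDegree S := by exact_mod_cast hS
  have hnorm : ‖Complex.I * (t : ℂ)‖ = |t| := by simp
  have hnorm' : ‖-(Complex.I * (t : ℂ))‖ = |t| := by rw [norm_neg, hnorm]
  have hs0 : 0 ≤ |t| + ‖z‖ + |t| := by positivity
  refine norm_insert_sub_le (F := fun A => partitionFunction H₁ H₂ ρ t A z)
    (x := Real.exp (|t| + ‖z‖ + |t|) - 1) (a := 1 + 1 / (interactionDegree S : ℝ))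
    (Δ := interactionDegree S) (interactionGraph S) (fun Y => ?_)
    (sub_nonneg.2 (Real.one_le_exp hs0)) (le_add_of_nonneg_right (by positivity))
    (exp_sub_one_mul_pow_le hS hs0 (by linarith)) ?_
    (fun A B hAB h => partitionFunction_union H₁ H₂ hρ t z hAB h) (fun D => ?_) X A hX
  · unfold interactionDegree
    convert (interactionGraph S).degree_le_maxDegree Y
  · have h3 : (1 + 1 / (interactionDegree S : ℝ)) * (1 - 1 / (3 * interactionDegree S)) =
        1 + 1 / (3 * interactionDegree S) +
          (interactionDegree S - 1) / (3 * (interactionDegree S : ℝ) ^ 2) := by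
      field_simp
      ring
    rw [h3]
    have : 0 ≤ (interactionDegree S : ℝ) - 1 := by linarith
    exact le_add_of_nonneg_right (by positivity)
  · exact norm_setDiff_trace_tripleExp_le hρ
      (fun X => (H₁.norm_smul_term_le _ X).trans_eq hnorm) (fun X => H₂.norm_smul_term_le _ X)
      (fun X => (H₁.norm_smul_term_le _ X).trans_eq hnorm') D

omit [Fintype V] in
lemma thresholdTime_pos (hS : 1 ≤ interactionDegree S) : 0 < thresholdTime S := by
  have hn : (1 : ℝ) ≤ interactionDegree S := by exact_mod_cast hS
  unfold thresholdTime
  positivity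

/-- The moment generating function of `H₂` in the evolved state is sub-Gaussian near `0`, with
variance proxy proportional to the number of subsystems. -/
lemma mgf_evolve_le (hS : 1 ≤ interactionDegree S) (H₁ H₂ : LocalHamiltonian d k S) {ρ : Op V d}
    (hρ : IsProductState ρ) {t : ℝ} (ht : |t| ≤ thresholdTime S / 7) {τ : ℝ}
    (hτ : |τ| < thresholdTime S) :
    (evolve H₁.toOp t ρ * NormedSpace.exp ((τ : ℂ) • H₂.toOp)).trace.re ≤
      Real.exp (τ * mean (evolve H₁.toOp t ρ) H₂.toOp +
        2 * S.card / thresholdTime S ^ 2 * τ ^ 2) := by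
  have hn : (1 : ℝ) ≤ interactionDegree S := by exact_mod_cast hS
  have hT := thresholdTime_pos hS
  have hball : ∀ z ∈ ball (0 : ℂ) (thresholdTime S), ‖z‖ ≤ thresholdTime S := fun z hz =>
    (mem_ball_zero_iff.1 hz).le
  obtain ⟨φ, hφd, hφ0, hφe, hφn⟩ := exists_log
    (F := partitionFunction H₁ H₂ ρ t) (r := thresholdTime S)
    (ε := 1 / (3 * interactionDegree S))
    (fun A => (differentiable_partitionFunction H₁ H₂ ρ t A).differentiableOn)
    (partitionFunction_empty H₁ H₂ hρ.trace_eq_one t)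
    (partitionFunction_zero H₁ H₂ hρ.trace_eq_one t)
    (one_div_le_one_div_of_le (by norm_num) (by linarith))
    (fun z hz X A hX => norm_partitionFunction_insert_sub_le hS H₁ H₂ hρ ht (hball z hz) X A hX)
    Finset.univ
  have hderiv : deriv φ 0 = (evolve H₁.toOp t ρ * H₂.toOp).trace := by
    have h1 := ((hφd.differentiableAt (ball_mem_nhds 0 hT)).hasDerivAt).cexp
    rw [hφ0, Complex.exp_zero, one_mul] at h1
    refine h1.unique ((hasDerivAt_partitionFunction_univ H₁ H₂ ρ t).congr_of_eventuallyEq ?_)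
    filter_upwards [ball_mem_nhds (0 : ℂ) hT] with z hz using hφe z hz
  have hτ' : (τ : ℂ) ∈ ball (0 : ℂ) (thresholdTime S) := by simpa using hτ
  have hquad := norm_sub_deriv_mul_le hT hφd hφ0 hφn hτ'
  rw [hderiv] at hquad
  have hre := (Complex.re_le_norm _).trans hquad
  rw [Complex.sub_re, Complex.re_ofReal_mul, Complex.norm_real, Real.norm_eq_abs, sq_abs,
    Finset.card_univ, Fintype.card_coe] at hre
  rw [← partitionFunction_univ, ← hφe _ hτ']
  refine (Complex.re_le_norm _).trans ?_
  rw [Complex.norm_exp]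
  refine Real.exp_le_exp.2 ?_
  unfold mean
  linarith

end ShortTime

end ShortTimeDynamics

open ShortTimeDynamics in
theorem mainTheorem6 {V : Type*} [Fintype V] [DecidableEq V] (d k : ℕ)
    (S : Finset (Finset V)) (hS : 1 ≤ interactionDegree S)
    (H₁ H₂ : LocalHamiltonian d k S)
    (ρ : Op V d) (hρ : IsProductState ρ)
    (t : ℝ) (ht : |t| ≤ thresholdTime S / 7)
    (δ : ℝ) (hδ : 0 ≤ δ) :
    deviationProb (evolve H₁.toOp t ρ) H₂.toOp δ ≤
      2 * Real.exp (-((δ * thresholdTime S) ^ 2 / (250 ^ 2 * (S.card : ℝ)))) := by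
  have hT := thresholdTime_pos hS
  have hT1 : thresholdTime S ≤ 1 := by
    have hn : (1 : ℝ) ≤ interactionDegree S := by exact_mod_cast hS
    have he : 1 ≤ Real.exp 1 := Real.one_le_exp zero_le_one
    unfold thresholdTime
    refine div_le_one_of_le₀ ?_ (by positivity)
    calc (1 : ℝ) ≤ 2 * 1 ^ 2 * 1 * (1 + 1) := by norm_num
      _ ≤ _ := by gcongr
  have hpsd := evolve_posSemidef H₁.isHermitian_toOp hρ.posSemidef t
  have htr : (evolve H₁.toOp t ρ).trace = 1 := (trace_evolve _ _ _).trans hρ.trace_eq_one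
  rcases lt_or_ge (2 * (S.card : ℝ)) δ with hlarge | hsmall
  · rw [deviationProb_eq_zero hpsd htr
      ((mul_le_mul_of_nonneg_left H₂.norm_toOp_le zero_le_two).trans_lt hlarge)]
    positivity
  have hcard : 0 < (S.card : ℝ) := by
    rw [Nat.cast_pos, Finset.card_pos, Finset.nonempty_iff_ne_empty]
    rintro rfl
    classical
    have h0 : interactionDegree (∅ : Finset (Finset V)) = 0 :=
      (interactionGraph _).maxDegree_of_subsingleton
    omega
  generalize hTdef : thresholdTime S = T at *
  generalize hNdef : (S.card : ℝ) = N at *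
  -- The optimal exponent for the variance proxy `31250 N / T ^ 2`, larger than the one available.
  let τ := δ * T ^ 2 / (31250 * N)
  have hτ0 : 0 ≤ τ := by positivity
  have hτT : τ < T := by
    rw [div_lt_iff₀ (by positivity)]
    nlinarith [mul_pos hT hcard, mul_le_mul hsmall hT1 hT.le (by positivity)]
  have h₁ := mgf_evolve_le hS H₁ H₂ hρ (hTdef ▸ ht) (τ := τ) (by rwa [abs_of_nonneg hτ0, hTdef])
  have h₂ := mgf_evolve_le hS H₁ H₂ hρ (hTdef ▸ ht) (τ := -τ)
    (by rwa [abs_neg, abs_of_nonneg hτ0, hTdef])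
  rw [neg_sq] at h₂
  refine (deviationProb_le_of_mgf_le H₂.isHermitian_toOp hpsd hτ0 h₁ h₂).trans ?_
  refine mul_le_mul_of_nonneg_left (Real.exp_le_exp.2 ?_) zero_le_two
  rw [hTdef, hNdef]
  have e1 : (δ * T) ^ 2 / (250 ^ 2 * N) = 15625 * N / T ^ 2 * τ ^ 2 := by
    simp only [τ]; field_simp; ring
  have e2 : τ * δ = 31250 * N / T ^ 2 * τ ^ 2 := by
    simp only [τ]; field_simp
  rw [e1, e2]
  have : 0 ≤ N / T ^ 2 * τ ^ 2 := by positivity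
  have e3 : ∀ c : ℝ, c * N / T ^ 2 * τ ^ 2 = c * (N / T ^ 2 * τ ^ 2) := fun c => by ring
  rw [e3, e3, e3]
  linarith
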